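/- Throughout, an algebra is a nonempty set with a family of finitary operations (of arbitrary type), and a variety is the class of all algebras of a given type that satisfy a given set of identities. A binary relation on an algebra $A$ is compatible if it is preserved by all basic operations of $A$; a tolerance is a compatible, reflexive and symmetric relation, and a congruence is a compatible equivalence relation. For binary relations, $R\circ S=\{(a,b) : \exists c\ (a\,R\,c \text{ and } c\,S\,b)\}$, and $R^-$ is the converse of $R$. A tolerance $\Theta$ of $A$ is representable if $\Theta=R\circ R^-$ for some compatible reflexive relation $R$ on $A$, and weakly representable if $\Theta=\bigcap_{k\in K}(R_k\circ R_k^-)$ for some set $K$ (possibly infinite) and some compatible reflexive relations $R_k$ ($k\in K$) on $A$. A variety is congruence permutable if $\alpha\circ\beta=\beta\circ\alpha$ for all congruences $\alpha,\beta$ of every algebra in it. A strong Mal'cev condition is a finite set of identities in finitely many operation symbols; a variety $\mathcal V$ satisfies it if each $n$-ary symbol can be replaced by an $n$-ary term of $\mathcal V$ so that all the resulting identities hold in $\mathcal V$. A Mal'cev condition is a sequence $(\mathcal M_n)_{n\in\mathbb N}$ of strong Mal'cev conditions such that every variety satisfying $\mathcal M_n$ satisfies $\mathcal M_{n+1}$;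 a variety satisfies it if it satisfies $\mathcal M_n$ for some $n$. A weak Mal'cev condition is a countable family of Mal'cev conditions; a variety satisfies it if it satisfies all of them. Such a condition implies a property of varieties if every variety that satisfies the condition has the property. **Corollary 3.** Let $\mathcal M$ be either a Mal'cev condition, or a weak Mal'cev condition, or a strong Mal'cev condition. The following are equivalent: (i) $\mathcal M$ implies congruence permutability. (ii) $\mathcal M$ implies that every tolerance of every algebra in the variety is representable. (iii) $\mathcal M$ implies that every tolerance of every algebra in the variety is weakly representable. -/

import Mathlib

universe u

/-! Algebras are nonempty structures for a first-order language without relation symbols. -/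

namespace UAlg

section Relations

variable (L : FirstOrder.Language.{u, 0}) {A : Type u} [L.Structure A]

/-- A binary relation is compatible (admissible) if all basic operations preserve it. -/
def Compatible (R : A → A → Prop) : Prop :=
  ∀ (n : ℕ) (f : L.Functions n) (x y : Fin n → A),
    (∀ i, R (x i) (y i)) →
      R (FirstOrder.Language.Structure.funMap f x) (FirstOrder.Language.Structure.funMap f y)

/-- A tolerance: a compatible, reflexive and symmetric relation. -/
structure IsTolerance (Θ : A → A → Prop) : Prop where
  compatible : Compatible L Θ
  refl : ∀ a, Θ a a
  symm : ∀ a b, Θ a b → Θ b a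

/-- A congruence: a compatible equivalence relation. -/
structure IsCongruence (α : A → A → Prop) : Prop where
  compatible : Compatible L α
  equivalence : Equivalence α

/-- `Θ = R ∘ R⁻` for some compatible and reflexive relation `R`. -/
def IsRepresentable (Θ : A → A → Prop) : Prop :=
  ∃ R : A → A → Prop, Compatible L R ∧ (∀ a, R a a) ∧
    ∀ a b, Θ a b ↔ Relation.Comp R (flip R) a b

/-- `Θ = ⋂ k, R k ∘ (R k)⁻` for some family of compatible and reflexive relations `R k`. -/
def IsWeaklyRepresentable (Θ : A → A → Prop) : Prop :=
  ∃ (K : Type u) (R : K → A → A → Prop),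
    (∀ k, Compatible L (R k)) ∧ (∀ k a, R k a a) ∧
      ∀ a b, Θ a b ↔ ∀ k, Relation.Comp (R k) (flip (R k)) a b

end Relations

/-- An identity `lhs ≈ rhs` between terms in countably many variables. -/
structure Identity (L : FirstOrder.Language.{u, 0}) where
  lhs : L.Term ℕ
  rhs : L.Term ℕ

/-- The identity holds in the algebra `A`. -/
def Identity.HoldsIn {L : FirstOrder.Language.{u, 0}} (e : Identity L)
    (A : Type u) [L.Structure A] : Prop :=
  ∀ v : ℕ → A, e.lhs.realize v = e.rhs.realize v

/-- A variety (equational class), given by its type of algebras and a set of defining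
identities. The type may have arbitrarily many operation symbols. -/
structure Variety where
  lang : FirstOrder.Language.{u, 0}
  algebraic : lang.IsAlgebraic
  identities : Set (Identity lang)

namespace Variety

/-- The algebra `A` belongs to the variety `V`. -/
def Contains (V : Variety.{u}) (A : Type u) [V.lang.Structure A] : Prop :=
  Nonempty A ∧ ∀ e ∈ V.identities, e.HoldsIn A

/-- The identity holds in all algebras of `V`. -/
def Satisfies (V : Variety.{u}) (e : Identity V.lang) : Prop :=
  ∀ (A : Type u) [V.lang.Structure A], V.Contains A → e.HoldsIn A

/-- Any two congruences of any algebra in `V` permute. -/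
def CongruencePermutable (V : Variety.{u}) : Prop :=
  ∀ (A : Type u) [V.lang.Structure A], V.Contains A →
    ∀ α β : A → A → Prop, IsCongruence V.lang α → IsCongruence V.lang β →
      Relation.Comp α β = Relation.Comp β α

/-- Every tolerance of every algebra in `V` is representable. -/
def TolerancesRepresentable (V : Variety.{u}) : Prop :=
  ∀ (A : Type u) [V.lang.Structure A], V.Contains A →
    ∀ Θ : A → A → Prop, IsTolerance V.lang Θ → IsRepresentable V.lang Θ

/-- Every tolerance of every algebra in `V` is weakly representable. -/
def TolerancesWeaklyRepresentable (V : Variety.{u}) : Prop :=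
  ∀ (A : Type u) [V.lang.Structure A], V.Contains A →
    ∀ Θ : A → A → Prop, IsTolerance V.lang Θ → IsWeaklyRepresentable V.lang Θ

end Variety

/-- A strong Mal'cev condition: finitely many identities in finitely many operation symbols. -/
structure StrongMalcevCondition where
  lang : FirstOrder.Language.{0, 0}
  algebraic : lang.IsAlgebraic
  finite_lang : Finite (Σ n, lang.Functions n)
  identities : Set (Identity lang)
  finite_identities : identities.Finite

/-- A variety satisfies a strong Mal'cev condition if each `n`-ary operation symbol of the
condition can be replaced by an `n`-ary term of the variety so that all the resulting identities
hold throughout the variety. -/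
def StrongMalcevCondition.SatisfiedBy (S : StrongMalcevCondition) (V : Variety.{u}) : Prop :=
  ∃ t : ∀ n, S.lang.Functions n → V.lang.Term (Fin n),
    ∀ e ∈ S.identities,
      V.Satisfies ⟨e.lhs.substFunc (fun {n} f => t n f), e.rhs.substFunc (fun {n} f => t n f)⟩

/-- A Mal'cev condition: a sequence of successively weaker strong Mal'cev conditions. -/
structure MalcevCondition where
  strong : ℕ → StrongMalcevCondition
  weaker : ∀ (n : ℕ) (V : Variety.{u}), (strong n).SatisfiedBy V → (strong (n + 1)).SatisfiedBy V

/-- A variety satisfies a Mal'cev condition if it satisfies some member of the sequence. -/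
def MalcevCondition.SatisfiedBy (M : MalcevCondition.{u}) (V : Variety.{u}) : Prop :=
  ∃ n, (M.strong n).SatisfiedBy V

/-- A weak Mal'cev condition: a conjunction of countably many Mal'cev conditions. -/
structure WeakMalcevCondition where
  conjunct : ℕ → MalcevCondition.{u}

/-- A variety satisfies a weak Mal'cev condition if it satisfies every conjunct. -/
def WeakMalcevCondition.SatisfiedBy (M : WeakMalcevCondition.{u}) (V : Variety.{u}) : Prop :=
  ∀ i, (M.conjunct i).SatisfiedBy V

/-- A condition of one of the three kinds. -/
inductive AnyMalcevCondition where
  | ordinary (M : MalcevCondition.{u})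
  | weak (M : WeakMalcevCondition.{u})
  | strong (M : StrongMalcevCondition)

/-- Satisfaction of a condition of one of the three kinds. -/
def AnyMalcevCondition.SatisfiedBy : AnyMalcevCondition.{u} → Variety.{u} → Prop
  | .ordinary M, V => M.SatisfiedBy V
  | .weak M, V => M.SatisfiedBy V
  | .strong M, V => M.SatisfiedBy V

/-- The condition implies the property `P` of varieties. -/
def AnyMalcevCondition.Implies (M : AnyMalcevCondition.{u}) (P : Variety.{u} → Prop) : Prop :=
  ∀ V : Variety.{u}, M.SatisfiedBy V → P V

end UAlg

/-! Transitivity of tolerances links the properties. In a congruence permutable variety every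
tolerance is transitive (`tolerance_trans`), and a transitive tolerance represents itself.
Conversely, if all tolerances of an algebra are transitive, its congruences permute
(`comp_comm_of_tolerances_transitive`).

To get transitivity from weak representability, the condition is used on a larger variety: adjoining
operations without identities keeps a Mal'cev condition true. Adjoin all operations preserving a
tolerance `Θ`. Every compatible relation outside the diagonal then contains `Θ`
(`Compatible.le_of_ne`), so a weak representation of `Θ` forces `Θ ∘ Θ ⊆ Θ`. -/

namespace UAlg

open FirstOrder FirstOrder.Language

section Terms

variable {L L' S : FirstOrder.Language} {α β : Type*}

theorem onTerm_subst (φ : L →ᴸ L') (t : L.Term α) (s : α → L.Term β) :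
    φ.onTerm (t.subst s) = (φ.onTerm t).subst (fun a => φ.onTerm (s a)) := by
  induction t with
  | var a => rfl
  | func f ts ih => simp only [Term.subst, LHom.onTerm, ih]

theorem onTerm_substFunc (φ : L →ᴸ L') (c : ∀ n, S.Functions n → L.Term (Fin n))
    (t : S.Term α) :
    φ.onTerm (t.substFunc (fun {n} f => c n f)) =
      t.substFunc (fun {n} f => φ.onTerm (c n f)) := by
  induction t with
  | var a => rfl
  | func f ts ih => simp only [Term.substFunc, onTerm_subst, ih]

end Terms

section Relations

variable {L : FirstOrder.Language.{u, 0}} {A : Type u} [L.Structure A]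

/-- Transitive tolerances are representable. -/
theorem IsTolerance.isRepresentable {Θ : A → A → Prop} (hΘ : IsTolerance L Θ)
    (htrans : ∀ a b c, Θ a b → Θ b c → Θ a c) : IsRepresentable L Θ :=
  ⟨Θ, hΘ.compatible, hΘ.refl, fun a b =>
    ⟨fun h => ⟨b, h, hΘ.refl b⟩, fun ⟨c, hac, hbc⟩ => htrans a c b hac (hΘ.symm b c hbc)⟩⟩

theorem IsRepresentable.isWeaklyRepresentable {Θ : A → A → Prop}
    (h : IsRepresentable L Θ) : IsWeaklyRepresentable L Θ := by
  obtain ⟨R, hc, hr, h⟩ := h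
  exact ⟨PUnit, fun _ => R, fun _ => hc, fun _ => hr, fun a b =>
    ⟨fun hab _ => (h a b).1 hab, fun hab => (h a b).2 (hab ⟨⟩)⟩⟩

theorem Compatible.comp {R S : A → A → Prop} (hR : Compatible L R) (hS : Compatible L S) :
    Compatible L (Relation.Comp R S) := by
  intro n f x y h
  choose z hxz hzy using h
  exact ⟨_, hR n f x z hxz, hS n f z y hzy⟩

/-- If every tolerance of an algebra is transitive, then its congruences permute. -/
theorem comp_comm_of_tolerances_transitive
    (htrans : ∀ Θ : A → A → Prop, IsTolerance L Θ → ∀ a b c, Θ a b → Θ b c → Θ a c)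
    {α β : A → A → Prop} (hα : IsCongruence L α) (hβ : IsCongruence L β) :
    Relation.Comp α β = Relation.Comp β α := by
  have hswap : ∀ {γ δ : A → A → Prop}, IsCongruence L γ → IsCongruence L δ → ∀ {a b},
      Relation.Comp γ δ a b → Relation.Comp δ γ b a :=
    fun hγ hδ _ _ ⟨c, h, h'⟩ => ⟨c, hδ.equivalence.symm h', hγ.equivalence.symm h⟩
  -- Intersecting with the reversed composite makes the relation symmetric; it still contains both
  -- `α` and `β`.
  have hΘ : IsTolerance L (fun a b => Relation.Comp α β a b ∧ Relation.Comp β α a b) :=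
    { compatible := fun n f x y h =>
        ⟨hα.compatible.comp hβ.compatible n f x y fun i => (h i).1,
          hβ.compatible.comp hα.compatible n f x y fun i => (h i).2⟩
      refl := fun a => ⟨⟨a, hα.equivalence.refl a, hβ.equivalence.refl a⟩,
        ⟨a, hβ.equivalence.refl a, hα.equivalence.refl a⟩⟩
      symm := fun _ _ h => ⟨hswap hβ hα h.2, hswap hα hβ h.1⟩ }
  have key := htrans _ hΘ
  have hleft : ∀ a b, α a b → Relation.Comp α β a b ∧ Relation.Comp β α a b :=
    fun a b h => ⟨⟨b, h, hβ.equivalence.refl b⟩, ⟨a, hβ.equivalence.refl a, h⟩⟩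
  have hright : ∀ a b, β a b → Relation.Comp α β a b ∧ Relation.Comp β α a b :=
    fun a b h => ⟨⟨a, hα.equivalence.refl a, h⟩, ⟨b, h, hα.equivalence.refl b⟩⟩
  funext a b
  refine propext ⟨fun ⟨c, h, h'⟩ => ?_, fun ⟨c, h, h'⟩ => ?_⟩
  · exact (key a c b (hleft a c h) (hright c b h')).2
  · exact (key a c b (hright a c h) (hleft c b h')).1

end Relations

/-! ### Tolerances as subalgebras of the square -/

section Square

variable {L : FirstOrder.Language.{u, 0}} {A : Type u} [L.Structure A]

/-- A compatible relation on `A`, as an algebra of pairs with coordinatewise operations. -/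
@[reducible] def pairStructure (hL : L.IsAlgebraic) {Θ : A → A → Prop} (hΘ : Compatible L Θ) :
    L.Structure {p : A × A // Θ p.1 p.2} where
  funMap f x := ⟨(Structure.funMap f fun i => (x i).1.1, Structure.funMap f fun i => (x i).1.2),
    hΘ _ f _ _ fun i => (x i).2⟩
  RelMap r := ((hL _).false r).elim

theorem realize_pairStructure (hL : L.IsAlgebraic) {Θ : A → A → Prop} (hΘ : Compatible L Θ)
    (t : L.Term ℕ) (v : ℕ → {p : A × A // Θ p.1 p.2}) :
    letI := pairStructure hL hΘ
    (t.realize v).1 = (t.realize fun i => (v i).1.1, t.realize fun i => (v i).1.2) := by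
  let := pairStructure hL hΘ
  induction t with
  | var a => rfl
  | func f ts ih =>
    simp only [Term.realize]
    change (Structure.funMap f (fun i => ((ts i).realize v).1.1),
      Structure.funMap f (fun i => ((ts i).realize v).1.2)) = _
    simp only [ih]

theorem contains_pairStructure (V : Variety.{u}) {A : Type u} [V.lang.Structure A]
    (hA : V.Contains A) {Θ : A → A → Prop} (hΘ : IsTolerance V.lang Θ) :
    letI := pairStructure V.algebraic hΘ.compatible
    V.Contains {p : A × A // Θ p.1 p.2} := by
  let := pairStructure V.algebraic hΘ.compatible
  obtain ⟨⟨a⟩, h⟩ := hA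
  refine ⟨⟨⟨(a, a), hΘ.refl a⟩⟩, fun e he v => Subtype.ext ?_⟩
  rw [realize_pairStructure, realize_pairStructure, h e he, h e he]

/-- The projection kernels of a tolerance, viewed as an algebra of pairs, permute only if the
tolerance is transitive. -/
theorem Variety.CongruencePermutable.tolerance_trans {V : Variety.{u}}
    (hV : V.CongruencePermutable) {A : Type u} [V.lang.Structure A] (hA : V.Contains A)
    {Θ : A → A → Prop} (hΘ : IsTolerance V.lang Θ) (a b c : A) (hab : Θ a b) (hbc : Θ b c) :
    Θ a c := by
  let := pairStructure V.algebraic hΘ.compatible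
  have h := hV _ (contains_pairStructure V hA hΘ) (fun p q => p.1.2 = q.1.2)
    (fun p q => p.1.1 = q.1.1)
    ⟨fun _ f _ _ h => congrArg (Structure.funMap f) (funext h),
      ⟨fun _ => rfl, fun h => h.symm, fun h h' => h.trans h'⟩⟩
    ⟨fun _ f _ _ h => congrArg (Structure.funMap f) (funext h),
      ⟨fun _ => rfl, fun h => h.symm, fun h h' => h.trans h'⟩⟩
  -- The pair `(b, b)` links `(a, b)` to `(b, c)`. Permuting the kernels gives a pair in `Θ` that
  -- must be `(a, c)`.
  obtain ⟨⟨⟨x, y⟩, hxy⟩, h₁, h₂⟩ := (congrFun (congrFun h ⟨(a, b), hab⟩) ⟨(b, c), hbc⟩).mp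
    ⟨⟨(b, b), hΘ.refl b⟩, rfl, rfl⟩
  simp only at h₁ h₂
  rwa [h₁, ← h₂]

end Square

/-! ### Expansion by polymorphisms of a tolerance -/

section Expansion

/-- The language with a symbol for each finitary operation preserving `Θ`. -/
def polymorphismLanguage {A : Type u} (Θ : A → A → Prop) : FirstOrder.Language.{u, 0} where
  Functions n := {f : (Fin n → A) → A // ∀ x y, (∀ i, Θ (x i) (y i)) → Θ (f x) (f y)}
  Relations _ := Empty

instance {A : Type u} (Θ : A → A → Prop) : (polymorphismLanguage Θ).Structure A where
  funMap f x := f.1 x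
  RelMap r := r.elim

/-- The variety obtained by adjoining operation symbols, without new identities. -/
def Variety.expand (V : Variety.{u}) (L' : FirstOrder.Language.{u, 0}) (hL' : L'.IsAlgebraic) :
    Variety.{u} where
  lang := V.lang.sum L'
  algebraic n := ⟨fun r => r.elim (V.algebraic n).false (hL' n).false⟩
  identities := (fun e : Identity V.lang =>
    ⟨LHom.sumInl.onTerm e.lhs, LHom.sumInl.onTerm e.rhs⟩) '' V.identities

/-- The old terms still serve: reducts of algebras in the expanded variety lie in `V`, and term
values do not change under reducts. -/
theorem StrongMalcevCondition.SatisfiedBy.expand {S : StrongMalcevCondition} {V : Variety.{u}}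
    (h : S.SatisfiedBy V) (L' : FirstOrder.Language.{u, 0}) (hL' : L'.IsAlgebraic) :
    S.SatisfiedBy (V.expand L' hL') := by
  obtain ⟨t, ht⟩ := h
  refine ⟨fun n f => (LHom.sumInl : V.lang →ᴸ V.lang.sum L').onTerm (t n f), ?_⟩
  intro e he B _ hB v
  let : (V.lang.sum L').Structure B := ‹(V.expand L' hL').lang.Structure B›
  let : V.lang.Structure B := (LHom.sumInl : V.lang →ᴸ V.lang.sum L').reduct B
  have : (LHom.sumInl : V.lang →ᴸ V.lang.sum L').IsExpansionOn B :=
    LHom.isExpansionOn_reduct _ B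
  have hBV : V.Contains B := by
    refine ⟨hB.1, fun d hd w => ?_⟩
    have := hB.2 _ ⟨d, hd, rfl⟩ w
    change ((LHom.sumInl : V.lang →ᴸ V.lang.sum L').onTerm d.lhs).realize w =
      ((LHom.sumInl : V.lang →ᴸ V.lang.sum L').onTerm d.rhs).realize w at this
    rwa [LHom.realize_onTerm, LHom.realize_onTerm] at this
  have h := ht e he B hBV v
  rw [← LHom.realize_onTerm (LHom.sumInl : V.lang →ᴸ V.lang.sum L'),
    ← LHom.realize_onTerm (LHom.sumInl : V.lang →ᴸ V.lang.sum L'),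
    onTerm_substFunc, onTerm_substFunc] at h
  exact h

theorem MalcevCondition.SatisfiedBy.expand {M : MalcevCondition.{u}} {V : Variety.{u}}
    (h : M.SatisfiedBy V) (L' : FirstOrder.Language.{u, 0}) (hL' : L'.IsAlgebraic) :
    M.SatisfiedBy (V.expand L' hL') :=
  let ⟨n, hn⟩ := h
  ⟨n, hn.expand L' hL'⟩

theorem AnyMalcevCondition.SatisfiedBy.expand {M : AnyMalcevCondition.{u}} {V : Variety.{u}}
    (h : M.SatisfiedBy V) (L' : FirstOrder.Language.{u, 0}) (hL' : L'.IsAlgebraic) :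
    M.SatisfiedBy (V.expand L' hL') := by
  cases M with
  | ordinary M => exact MalcevCondition.SatisfiedBy.expand h L' hL'
  | weak M => exact fun i => MalcevCondition.SatisfiedBy.expand (h i) L' hL'
  | strong M => exact StrongMalcevCondition.SatisfiedBy.expand h L' hL'

variable {L : FirstOrder.Language.{u, 0}} {A : Type u} [L.Structure A]

theorem Compatible.sum_polymorphismLanguage {Θ : A → A → Prop} (h : Compatible L Θ) :
    Compatible (L.sum (polymorphismLanguage Θ)) Θ := by
  rintro n (f | f) x y hxy
  · exact h n f x y hxy
  · exact f.2 x y hxy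

/-- A compatible relation with a pair of distinct elements contains `Θ`, because every map into
`{c, d}` preserves `Θ` when `Θ c d`. -/
theorem Compatible.le_of_ne {Θ R : A → A → Prop} (hΘ : IsTolerance L Θ)
    (hR : Compatible (L.sum (polymorphismLanguage Θ)) R) {a b : A} (hab : R a b) (hne : a ≠ b)
    {c d : A} (hcd : Θ c d) : R c d := by
  classical
  let f : (polymorphismLanguage Θ).Functions 1 := ⟨fun x => if x 0 = a then c else d, by
    intro x y _
    dsimp only
    split_ifs
    exacts [hΘ.refl c, hcd, hΘ.symm _ _ hcd, hΘ.refl d]⟩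
  have h : R (if a = a then c else d) (if b = a then c else d) :=
    hR 1 (Sum.inr f) (fun _ => a) (fun _ => b) fun _ => hab
  rwa [if_pos rfl, if_neg hne.symm] at h

/-- A tolerance that is weakly representable in the expansion by all operations preserving it is
transitive. -/
theorem IsWeaklyRepresentable.trans_of_polymorphisms {Θ : A → A → Prop} (hΘ : IsTolerance L Θ)
    (h : IsWeaklyRepresentable (L.sum (polymorphismLanguage Θ)) Θ) (a b c : A)
    (hab : Θ a b) (hbc : Θ b c) : Θ a c := by
  obtain ⟨K, R, hR, -, hΘR⟩ := h
  rcases eq_or_ne a b with rfl | hne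
  · exact hbc
  refine (hΘR a c).2 fun k => ?_
  -- If `R k` were the diagonal, so would be `R k ∘ (R k)⁻`, which contains the pair `(a, b)` with
  -- `a ≠ b`.
  obtain ⟨x, y, hxy, hxy'⟩ : ∃ x y, R k x y ∧ x ≠ y := by
    obtain ⟨z, haz, hbz⟩ := (hΘR a b).1 hab k
    by_cases hz : a = z
    · exact ⟨b, z, hbz, fun hb => hne (hz.trans hb.symm)⟩
    · exact ⟨a, z, haz, hz⟩
  -- As `R k` contains `Θ`, the middle element `b` is a common `R k`-successor of `a` and `c`.
  exact ⟨b, (hR k).le_of_ne hΘ hxy hxy' hab, (hR k).le_of_ne hΘ hxy hxy' (hΘ.symm _ _ hbc)⟩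

theorem Variety.Contains.expand {V : Variety.{u}} [V.lang.Structure A] (hA : V.Contains A)
    (L' : FirstOrder.Language.{u, 0}) (hL' : L'.IsAlgebraic) [L'.Structure A] :
    letI : (V.expand L' hL').lang.Structure A := inferInstanceAs ((V.lang.sum L').Structure A)
    (V.expand L' hL').Contains A := by
  refine ⟨hA.1, ?_⟩
  rintro _ ⟨e, he, rfl⟩ v
  change ((LHom.sumInl : V.lang →ᴸ V.lang.sum L').onTerm e.lhs).realize v =
    ((LHom.sumInl : V.lang →ᴸ V.lang.sum L').onTerm e.rhs).realize v
  rw [LHom.realize_onTerm, LHom.realize_onTerm]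
  exact hA.2 e he v

theorem AnyMalcevCondition.Implies.congruencePermutable {M : AnyMalcevCondition.{u}}
    (h : M.Implies Variety.TolerancesWeaklyRepresentable) :
    M.Implies Variety.CongruencePermutable := by
  intro V hV A _ hA α β hα hβ
  refine comp_comm_of_tolerances_transitive (fun Θ hΘ => ?_) hα hβ
  have hL' : (polymorphismLanguage Θ).IsAlgebraic := fun _ => inferInstanceAs (IsEmpty Empty)
  let : (V.expand _ hL').lang.Structure A :=
    inferInstanceAs ((V.lang.sum (polymorphismLanguage Θ)).Structure A)
  exact IsWeaklyRepresentable.trans_of_polymorphisms hΘ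
    (h _ (hV.expand _ hL') A (hA.expand _ hL') Θ
      ⟨hΘ.compatible.sum_polymorphismLanguage, hΘ.refl, hΘ.symm⟩)

end Expansion

end UAlg

theorem corollary3 (M : UAlg.AnyMalcevCondition.{u}) :
    List.TFAE
      [M.Implies UAlg.Variety.CongruencePermutable,
       M.Implies UAlg.Variety.TolerancesRepresentable,
       M.Implies UAlg.Variety.TolerancesWeaklyRepresentable] := by
  tfae_have 1 → 2 := fun h V hV _ _ hA _ hΘ => hΘ.isRepresentable ((h V hV).tolerance_trans hA hΘ)
  tfae_have 2 → 3 := fun h V hV A _ hA Θ hΘ => (h V hV A hA Θ hΘ).isWeaklyRepresentable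
  tfae_have 3 → 1 := fun h => h.congruencePermutable
  tfae_finish
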